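/- \textbf{Stability bound for CNNs with generic activations.} Let $d\ge 0$, $\Omega=\mathbb R^d$ with Euclidean norm $|\cdot|$, let $h(u)=(2\pi)^{-d/2}e^{-|u|^2/2}$ and, for $s>0$, let $A_s z(u)=\int_{\mathbb R^d}s^{-d}h\big(\tfrac{u-v}{s}\big)z(v)\,dv$ be Gaussian pooling at scale $s$. \emph{The network.} A CNN with $n\ge 0$ layers is given by numbers of channels $p_0,\dots,p_n$; pooling scales $\sigma_0,\dots,\sigma_n>0$; compact patch shapes $S_1,\dots,S_n\subset\Omega$ of positive Lebesgue measure, with normalized uniform measures $\nu_k$; filters $w_k^i\in L^2(S_k,\nu_k;\mathbb R^{p_{k-1}})$, $1\le i\le p_k$; and $w_{n+1}\in L^2(\Omega,\mathbb R^{p_n})$. Let $W_k(v)$ be the matrix with rows $w_k^i(v)$ and $$\|W_k\|_2=\sup\Big\{\Big\|\int_{S_k}W_k(v)z(v)\,d\nu_k(v)\Big\| : z\in L^2(S_k,\nu_k;\mathbb R^{p_{k-1}}),\ \|z\|\le 1\Big\}.$$ For an activation $\sigma:\mathbb R\to\mathbb R$ and a signal $x\in L^2(\Omega,\mathbb R^{p_0})$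 set $z_0=A_{\sigma_0}x$ and, for $1\le k\le n$, $$z_k=A_{\sigma_k}\tilde z_k,\qquad \tilde z_k(u)=\sigma\Big(\int_{S_k}W_k(v)\,z_{k-1}(u+v)\,d\nu_k(v)\Big)\quad(\sigma\text{ applied component-wise}),$$ and $f_\sigma(x)=\langle w_{n+1},z_n\rangle_{L^2(\Omega,\mathbb R^{p_n})}$. \emph{The claim.} For every $d$ and every $\kappa>0$ there is a constant $C_1\ge 0$, depending only on $d$ and $\kappa$, such that with $C_2=2^d\|\nabla h\|_{L^1}$ the following holds for every CNN as above with $\sup_{c\in S_k}|c|\le\kappa\sigma_{k-1}$ for $k=1,\dots,n$, every $\rho\ge 0$, every $\rho$-Lipschitz $\sigma$ with $\sigma(0)=0$ (e.g. ReLU or tanh with $\rho=1$), every bounded $C^1$ map $\tau:\Omega\to\Omega$ with $\|\nabla\tau\|_\infty=\sup_u\|\nabla\tau(u)\|\le 1/2$ (operator norm), and every $x\in L^2(\Omega,\mathbb R^{p_0})$. With $L_\tau x(u)=x(u-\tau(u))$ and $\|\tau\|_\infty=\sup_u|\tau(u)|$, the feature maps $z_0,\dots,z_n$ of $x$ and of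 $L_\tau x$ are in $L^2$, and $$|f_\sigma(L_\tau x)-f_\sigma(x)|\le\rho^n\,\|w_{n+1}\|\Big(\prod_{k=1}^n\|W_k\|_2\Big)\Big(C_1(1+n)\|\nabla\tau\|_\infty+\frac{C_2}{\sigma_n}\|\tau\|_\infty\Big)\|x\|.$$ -/

import Mathlib

namespace GenericCNN

noncomputable section

/-- The spatial domain `Ω = ℝ^d`, with its Euclidean norm. -/
abbrev Dom (d : ℕ) : Type := EuclideanSpace ℝ (Fin d)

/-- The space `ℝ^p` of values of a signal with `p` channels, with its Euclidean norm. -/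
abbrev Chan (p : ℕ) : Type := EuclideanSpace ℝ (Fin p)

/-! ### Deformations -/

/-- The deformed signal `(L_τ x)(u) = x (u - τ u)`. -/
def warp {d p : ℕ} (τ : Dom d → Dom d) (x : Dom d → Chan p) : Dom d → Chan p :=
  fun u => x (u - τ u)

/-- `‖τ‖_∞`, the supremum of the Euclidean norms `|τ u|`. -/
def supNorm {d : ℕ} (τ : Dom d → Dom d) : ℝ := ⨆ u, ‖τ u‖

/-- `‖∇τ‖_∞`, the supremum of the operator norms of the Jacobians of `τ`. -/
def gradSupNorm {d : ℕ} (τ : Dom d → Dom d) : ℝ := ⨆ u, ‖fderiv ℝ τ u‖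

/-! ### Gaussian pooling -/

/-- The Gaussian `h u = (2π)^(-d/2) exp (-|u|²/2)`. -/
def gaussian {d : ℕ} (u : Dom d) : ℝ :=
  (2 * Real.pi) ^ (-(d : ℝ) / 2) * Real.exp (-‖u‖ ^ 2 / 2)

/-- The Gaussian of scale `s`, `h_s u = s^(-d) h (u / s)`. -/
def gaussianScale {d : ℕ} (s : ℝ) (u : Dom d) : ℝ := (s ^ d)⁻¹ * gaussian (s⁻¹ • u)

/-- The pooling operator `(A_s z)(u) = ∫ h_s(u - v) z(v) dv`. -/
def pool {d p : ℕ} (s : ℝ) (z : Dom d → Chan p) : Dom d → Chan p :=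
  fun u => ∫ v, gaussianScale s (u - v) • z v

/-- The constant `2^d ‖∇h‖_{L¹}`. -/
def translationConst (d : ℕ) : ℝ :=
  2 ^ d * ∫ u : Dom d, ‖gradient (gaussian (d := d)) u‖

/-! ### Patches and filters -/

/-- The normalized uniform (Lebesgue) measure on the patch shape `S`. -/
def patchMeasure {d : ℕ} (S : Set (Dom d)) : MeasureTheory.Measure (Dom d) :=
  ProbabilityTheory.cond MeasureTheory.volume S

/-- The patch of `z` at `u`, `v ↦ z (u + v)`. It is used only through integrals against
`patchMeasure S`, that is, for `v ∈ S`. -/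
def patch {d p : ℕ} (z : Dom d → Chan p) (u : Dom d) : Dom d → Chan p :=
  fun v => z (u + v)

/-- A bank of `p` filters `w^i ∈ L²(S, ℝ^q)`; the matrix `W(v)` has the rows `w^i(v)`. -/
abbrev FilterBank {d : ℕ} (S : Set (Dom d)) (q p : ℕ) : Type :=
  Fin p → MeasureTheory.Lp (Chan q) 2 (patchMeasure S)

/-- The vector `∫_S W(v) z(v) dν(v)`, with coordinates `⟨w^i, z⟩ = ∫_S ⟨w^i(v), z(v)⟩ dν(v)`. -/
def applyFilters {d q p : ℕ} {S : Set (Dom d)} (W : FilterBank S q p)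
    (z : Dom d → Chan q) : Chan p :=
  WithLp.toLp 2 fun i => ∫ v, inner ℝ (W i v) (z v) ∂(patchMeasure S)

/-- The spectral norm `‖W‖₂ = sup_{‖z‖ ≤ 1} ‖∫_S W(v) z(v) dν(v)‖`, over `z ∈ L²(S, ℝ^q)`. -/
def spectralNorm {d q p : ℕ} {S : Set (Dom d)} (W : FilterBank S q p) : ℝ :=
  sSup ((fun z : MeasureTheory.Lp (Chan q) 2 (patchMeasure S) => ‖applyFilters W z‖) ''
    Metric.closedBall 0 1)

/-- `z ↦ ∫_S W(v) z(v) dν(v)` as a bounded operator `L²(S, ℝ^q) → ℝ^p`. -/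
def filterCLM {d q p : ℕ} {S : Set (Dom d)} (W : FilterBank S q p) :
    MeasureTheory.Lp (Chan q) 2 (patchMeasure S) →L[ℝ] Chan p :=
  (EuclideanSpace.equiv (Fin p) ℝ).symm.toContinuousLinearMap.comp
    (ContinuousLinearMap.pi fun i => innerSL ℝ (W i))

theorem filterCLM_apply {d q p : ℕ} {S : Set (Dom d)} (W : FilterBank S q p)
    (z : MeasureTheory.Lp (Chan q) 2 (patchMeasure S)) :
    filterCLM W z = applyFilters W z := by
  ext i
  simp [filterCLM, applyFilters, MeasureTheory.L2.inner_def]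

theorem spectralNorm_eq {d q p : ℕ} {S : Set (Dom d)} (W : FilterBank S q p) :
    spectralNorm W = ‖filterCLM W‖ := by
  rw [← ContinuousLinearMap.sSup_unitClosedBall_eq_norm]
  simp only [spectralNorm, filterCLM_apply]

/-- The non-linear patch map `φ(z) = σ (∫_S W(v) z(v) dν(v))`, `σ` applied component-wise. -/
def patchMap {d q p : ℕ} {S : Set (Dom d)} (σ : ℝ → ℝ) (W : FilterBank S q p)
    (z : Dom d → Chan q) : Chan p :=
  WithLp.toLp 2 fun i => σ (applyFilters W z i)

/-! ### The network -/

/-- A convolutional network on signals on `ℝ^d`, with `n` convolutional layers. The layer `k + 1`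
of the usual numbering `1, …, n` has the index `k : Fin n`: its input has `p k.castSucc` channels,
its output has `p k.succ` channels, and its pooling scale is `scale k.succ`; `scale 0` is the scale
of the initial pooling operator. -/
structure ConvNet (d n : ℕ) where
  /-- numbers of channels `p_0, …, p_n` -/
  p : Fin (n + 1) → ℕ
  /-- patch shapes `S_1, …, S_n` -/
  S : Fin n → Set (Dom d)
  /-- pooling scales `σ_0, …, σ_n` -/
  scale : Fin (n + 1) → ℝ
  /-- filters `W_1, …, W_n` -/
  W : (k : Fin n) → FilterBank (S k) (p k.castSucc) (p k.succ)
  /-- parameters `w_{n+1} ∈ L²(ℝ^d, ℝ^{p_n})` of the linear prediction layer -/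
  wOut : MeasureTheory.Lp (Chan (p (Fin.last n))) 2 (MeasureTheory.volume : MeasureTheory.Measure (Dom d))
  isCompact_S : ∀ k, IsCompact (S k)
  volume_S_pos : ∀ k, 0 < MeasureTheory.volume (S k)
  scale_pos : ∀ k, 0 < scale k

/-- The feature maps: `z_0 = A_0 x` and `z_k = A_k z̃_k`, `z̃_k(u) = φ_k (P_k z_{k-1} (u))`. -/
def ConvNet.featureMap {d n : ℕ} (N : ConvNet d n) (σ : ℝ → ℝ) (x : Dom d → Chan (N.p 0))
    (k : Fin (n + 1)) : Dom d → Chan (N.p k) :=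
  Fin.induction (motive := fun k => Dom d → Chan (N.p k))
    (pool (N.scale 0) x)
    (fun k z => pool (N.scale k.succ) (fun u => patchMap σ (N.W k) (patch z u))) k

/-- The prediction `f_σ(x) = ⟨w_{n+1}, z_n⟩`, an inner product in `L²(ℝ^d, ℝ^{p_n})`. -/
def ConvNet.predict {d n : ℕ} (N : ConvNet d n) (σ : ℝ → ℝ) (x : Dom d → Chan (N.p 0)) : ℝ :=
  ∫ u, inner ℝ (N.wOut u) (N.featureMap σ x (Fin.last n) u)

end

end GenericCNN

/-!
Write `L_τ` for the deformation, `A_s` for pooling, `L_c` for the translation by `c`, and `Φ_k` for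
the map which extracts the patches of a signal, applies the filters `W_k` and then `σ`. The signals
before pooling satisfy `z̃_{k+1} = Φ_{k+1} (A_{σ_k} z̃_k)`. Two facts make the network stable.

* `Φ_k` is Lipschitz with constant `ρ ‖W_k‖₂`, also when the patches of the second signal are read
  off at displaced centres `ξ(u)` (`eLpNorm_patchMap_sub_le`): by Tonelli's theorem it is enough to
  compare the two signals at each fixed offset `v ∈ S_k`. With `ξ(u) = u - τ(u)` the displaced
  version is `L_τ Φ_k`. So `L_τ` commutes with each layer up to the commutators of `L_τ` with the
  operators `L_v A_{σ_{k-1}}`, `|v| ≤ κ σ_{k-1}`. This gives `n` commutators for the layers, and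
  one more for the last pooling operator, hence the factor `1 + n`.
* Each commutator has norm at most `C ‖∇τ‖_∞` (`eLpNorm_pool_warp_sub_le`). The change of
  variables `w = v - τ(v)` turns it into an integral operator applied to `L_τ z`, with kernel
  `h_s(u + c - v) - |det (1 - ∇τ(v))| h_s(u + c - v - (τ(u) - τ(v)))`.
  Since `|1 - |det (1 - ∇τ)|| ≤ 2^d ‖∇τ‖_∞` and `|τ(u) - τ(v)| ≤ ‖∇τ‖_∞ |u - v|`, it is dominated
  by `‖∇τ‖_∞` times a convolution kernel, a wider Gaussian whose integral depends on `d` and `κ`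
  only, and Schur's test `eLpNorm_le_of_kernel` applies.

What remains is `L_τ A_{σ_n} - A_{σ_n}`, which Schur's test bounds by
`2^d ‖∇h‖_{L¹} ‖τ‖_∞ / σ_n` (`eLpNorm_pool_comp_sub_pool_le`).

The volume distortion of `u ↦ u - τ(u)` is controlled by Hausdorff measures of images and preimages
under Lipschitz and antilipschitz maps. The `L²` norms are the extended nonnegative reals
`eLpNorm`, and all signals are strongly measurable functions, not classes modulo almost everywhere equality.
-/

namespace GenericCNN

open MeasureTheory Function Set
open scoped ENNReal NNReal

section

/-! ### Integral inequalities in `L²` -/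

section Schur

variable {α β E F : Type*} [MeasurableSpace α] [MeasurableSpace β]
  [NormedAddCommGroup E] [NormedAddCommGroup F] {μ : Measure α} {ν : Measure β}

theorem eLpNorm_two_sq (f : α → E) : eLpNorm f 2 μ ^ 2 = ∫⁻ a, ‖f a‖ₑ ^ 2 ∂μ := by
  have := eLpNorm_nnreal_pow_eq_lintegral (μ := μ) (f := f) (p := 2) (by norm_num)
  simpa using this

theorem eLpNorm_two_le_iff (f : α → E) (c : ℝ≥0∞) :
    eLpNorm f 2 μ ≤ c ↔ ∫⁻ a, ‖f a‖ₑ ^ 2 ∂μ ≤ c ^ 2 := by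
  rw [← eLpNorm_two_sq]
  exact (ENNReal.pow_right_strictMono two_ne_zero).le_iff_le.symm

/-- The Cauchy–Schwarz inequality for the measure of density `k`. -/
theorem sq_lintegral_mul_le {k f : β → ℝ≥0∞} (hk : Measurable k) (hf : Measurable f) :
    (∫⁻ v, k v * f v ∂ν) ^ 2 ≤ (∫⁻ v, k v ∂ν) * ∫⁻ v, k v * f v ^ 2 ∂ν := by
  have hsqrt : ∀ x : ℝ≥0∞, x ^ (1 / 2 : ℝ) * x ^ (1 / 2 : ℝ) = x := fun x => by
    rw [← ENNReal.rpow_add_of_nonneg _ _ (by norm_num) (by norm_num)]; norm_num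
  have h := ENNReal.lintegral_mul_le_Lp_mul_Lq ν Real.HolderConjugate.two_two
    (f := fun v => k v ^ (1 / 2 : ℝ)) (g := fun v => k v ^ (1 / 2 : ℝ) * f v)
    (by fun_prop) (by fun_prop)
  have h1 : ∀ v, (k v ^ (1 / 2 : ℝ)) ^ (2 : ℝ) = k v := fun v => by
    rw [← ENNReal.rpow_mul]; norm_num
  have h2 : ∀ v, (k v ^ (1 / 2 : ℝ) * f v) ^ (2 : ℝ) = k v * f v ^ 2 := fun v => by
    rw [ENNReal.mul_rpow_of_nonneg _ _ (by norm_num), h1]; norm_cast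
  simp only [Pi.mul_apply, ← mul_assoc, hsqrt, h1, h2] at h
  refine (pow_le_pow_left' h 2).trans_eq ?_
  rw [mul_pow, sq, sq, hsqrt, hsqrt]

/-- **Schur's test**, for a kernel whose row and column integrals have a common bound. -/
theorem eLpNorm_le_of_kernel [SFinite μ] [SFinite ν] {k : α → β → ℝ≥0∞} {c : ℝ≥0∞}
    {f : β → E} {g : α → F} (hk : Measurable (uncurry k)) (hf : Measurable fun v => ‖f v‖ₑ)
    (hg : ∀ u, ‖g u‖ₑ ≤ ∫⁻ v, k u v * ‖f v‖ₑ ∂ν)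
    (hrow : ∀ u, ∫⁻ v, k u v ∂ν ≤ c) (hcol : ∀ v, ∫⁻ u, k u v ∂μ ≤ c) :
    eLpNorm g 2 μ ≤ c * eLpNorm f 2 ν := by
  rw [eLpNorm_two_le_iff, mul_pow, eLpNorm_two_sq]
  have hk' : ∀ u, Measurable (k u) := fun u => hk.comp measurable_prodMk_left
  have hk'' : ∀ v, Measurable fun u => k u v := fun v => hk.comp measurable_prodMk_right
  calc ∫⁻ u, ‖g u‖ₑ ^ 2 ∂μ
      ≤ ∫⁻ u, c * ∫⁻ v, k u v * ‖f v‖ₑ ^ 2 ∂ν ∂μ := by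
        refine lintegral_mono fun u => (pow_le_pow_left' (hg u) 2).trans ?_
        exact (sq_lintegral_mul_le (hk' u) hf).trans (by gcongr; exact hrow u)
    _ = c * ∫⁻ u, ∫⁻ v, k u v * ‖f v‖ₑ ^ 2 ∂ν ∂μ := by
        refine lintegral_const_mul _ (Measurable.lintegral_prod_right' (ν := ν)
          (f := fun p : α × β => k p.1 p.2 * ‖f p.2‖ₑ ^ 2) ?_)
        exact hk.mul ((hf.comp measurable_snd).pow_const 2)
    _ = c * ∫⁻ v, ∫⁻ u, k u v * ‖f v‖ₑ ^ 2 ∂μ ∂ν := by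
        rw [lintegral_lintegral_swap]
        exact (hk.mul ((hf.comp measurable_snd).pow_const 2)).aemeasurable
    _ ≤ c * ∫⁻ v, c * ‖f v‖ₑ ^ 2 ∂ν := by
        gcongr with v
        rw [lintegral_mul_const _ (hk'' v)]
        gcongr
        exact hcol v
    _ = c ^ 2 * ∫⁻ v, ‖f v‖ₑ ^ 2 ∂ν := by
        rw [lintegral_const_mul _ (hf.pow_const 2), sq, mul_assoc]

end Schur

/-! ### Changes of variables -/

variable {d : ℕ}

/-- Lebesgue measure is a multiple of the Hausdorff measure, so no differentiability or change of
variables is needed here. -/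
theorem map_le_of_antilipschitz {ξ : Dom d → Dom d} {K : ℝ≥0} (hξ : AntilipschitzWith K ξ)
    (hm : Measurable ξ) :
    Measure.map ξ volume ≤ (K : ℝ≥0∞) ^ d • (volume : Measure (Dom d)) := by
  refine Measure.le_iff.2 fun s hs => ?_
  rw [Measure.map_apply hm hs, Measure.smul_apply,
    ← EuclideanSpace.euclideanHausdorffMeasure_eq_volume,
    Measure.euclideanHausdorffMeasure_def, Measure.smul_apply, Measure.smul_apply]
  have h := hξ.hausdorffMeasure_preimage_le (Nat.cast_nonneg d) s
  rw [ENNReal.rpow_natCast] at h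
  simp only [ENNReal.smul_def, smul_eq_mul]
  refine (mul_le_mul_right h _).trans_eq ?_
  ring

theorem volume_image_le_of_lipschitz {ξ : Dom d → Dom d} {K : ℝ≥0} (hξ : LipschitzWith K ξ)
    (s : Set (Dom d)) : volume (ξ '' s) ≤ (K : ℝ≥0∞) ^ d * volume s := by
  rw [← EuclideanSpace.euclideanHausdorffMeasure_eq_volume,
    Measure.euclideanHausdorffMeasure_def, Measure.smul_apply, Measure.smul_apply]
  have h := hξ.hausdorffMeasure_image_le (Nat.cast_nonneg d) s
  rw [ENNReal.rpow_natCast] at h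
  simp only [ENNReal.smul_def, smul_eq_mul]
  refine (mul_le_mul_right h _).trans_eq ?_
  ring

theorem lintegral_comp_le_of_antilipschitz {ξ : Dom d → Dom d} {K : ℝ≥0}
    (hξ : AntilipschitzWith K ξ) (hm : Measurable ξ) {f : Dom d → ℝ≥0∞} (hf : Measurable f) :
    ∫⁻ u, f (ξ u) ≤ (K : ℝ≥0∞) ^ d * ∫⁻ u, f u := by
  rw [← lintegral_map hf hm, ← smul_eq_mul, ← lintegral_smul_measure]
  exact lintegral_mono' (map_le_of_antilipschitz hξ hm) le_rfl

theorem quasiMeasurePreserving_of_antilipschitz {ξ : Dom d → Dom d} {K : ℝ≥0}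
    (hξ : AntilipschitzWith K ξ) (hm : Measurable ξ) :
    Measure.QuasiMeasurePreserving ξ volume volume :=
  ⟨hm, (Measure.absolutelyContinuous_of_le (map_le_of_antilipschitz hξ hm)).trans
    Measure.smul_absolutelyContinuous⟩

theorem lintegral_comp_inv_smul {s : ℝ} (hs : 0 < s) {f : Dom d → ℝ≥0∞} (hf : Measurable f) :
    ENNReal.ofReal (s ^ d)⁻¹ * ∫⁻ u, f (s⁻¹ • u) = ∫⁻ u, f u := by
  have h := Measure.map_addHaar_smul (volume : Measure (Dom d)) (inv_ne_zero hs.ne')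
  rw [finrank_euclideanSpace_fin, inv_pow, inv_inv, abs_of_pos (pow_pos hs d)] at h
  rw [← lintegral_map hf (measurable_const_smul s⁻¹), h, lintegral_smul_measure, smul_eq_mul,
    ← mul_assoc, ← ENNReal.ofReal_mul (by positivity), inv_mul_cancel₀ (by positivity),
    ENNReal.ofReal_one, one_mul]

/-- The determinant of a Lipschitz perturbation of the identity is read off from the volume of the
image of the unit ball. -/
theorem abs_det_id_sub_bounds {A : Dom d →L[ℝ] Dom d} {ε : ℝ} (hA : ‖A‖ ≤ ε) (hε : ε ≤ 1 / 2) :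
    |(1 - |(ContinuousLinearMap.id ℝ (Dom d) - A).det|)| ≤ 2 ^ d * ε := by
  set B := ContinuousLinearMap.id ℝ (Dom d) - A with hB
  have hε0 : 0 ≤ ε := (norm_nonneg A).trans hA
  have hAx : ∀ x y, ‖A x - A y‖ ≤ ε * ‖x - y‖ := fun x y => by
    rw [← map_sub]; exact A.le_of_opNorm_le hA _
  have hBlip : LipschitzWith (1 + ε).toNNReal B := by
    refine LipschitzWith.of_dist_le_mul fun x y => ?_
    rw [Real.coe_toNNReal _ (by linarith), dist_eq_norm, dist_eq_norm]
    have : B x - B y = (x - y) - (A x - A y) := by simp [hB]; abel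
    rw [this]
    linarith [norm_sub_le (x - y) (A x - A y), hAx x y]
  have hBanti : AntilipschitzWith ((1 - ε)⁻¹).toNNReal B := by
    refine AntilipschitzWith.of_le_mul_dist fun x y => ?_
    have h1 : 0 < 1 - ε := by linarith
    rw [Real.coe_toNNReal _ (by positivity), dist_eq_norm, dist_eq_norm, ← div_eq_inv_mul,
      le_div_iff₀ h1]
    have : B x - B y = (x - y) - (A x - A y) := by simp [hB]; abel
    rw [this]
    linarith [norm_sub_norm_le (x - y) (A x - A y), hAx x y]
  have hpos : 0 < volume (Metric.closedBall (0 : Dom d) 1) :=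
    (Metric.measure_ball_pos volume _ one_pos).trans_le (measure_mono Metric.ball_subset_closedBall)
  have hfin : volume (Metric.closedBall (0 : Dom d) 1) ≠ ∞ := measure_closedBall_lt_top.ne
  have hdet : volume (B '' Metric.closedBall 0 1) =
      ENNReal.ofReal |B.det| * volume (Metric.closedBall (0 : Dom d) 1) :=
    Measure.addHaar_image_continuousLinearMap volume B _
  have hup : |B.det| ≤ (1 + ε) ^ d := by
    have h := volume_image_le_of_lipschitz hBlip (Metric.closedBall 0 1)
    rw [hdet, ENNReal.mul_le_mul_iff_left hpos.ne' hfin] at h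
    change ENNReal.ofReal _ ≤ ENNReal.ofReal _ ^ d at h
    rwa [← ENNReal.ofReal_pow (by linarith),
      ENNReal.ofReal_le_ofReal_iff (pow_nonneg (by linarith) d)] at h
  have hlow : (1 - ε) ^ d ≤ |B.det| := by
    have hm : MeasurableSet (B '' Metric.closedBall 0 1) :=
      ((isCompact_closedBall (0 : Dom d) 1).image B.continuous).isClosed.measurableSet
    have h := map_le_of_antilipschitz hBanti B.continuous.measurable (B '' Metric.closedBall 0 1)
    rw [Measure.map_apply B.continuous.measurable hm, hBanti.injective.preimage_image,
      Measure.smul_apply, hdet, smul_eq_mul, ← mul_assoc] at h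
    have h' := (ENNReal.mul_le_mul_iff_left hpos.ne' hfin).1 ((one_mul _).trans_le h)
    change 1 ≤ ENNReal.ofReal _ ^ d * _ at h'
    have h1 : 0 < 1 - ε := by linarith
    rw [← ENNReal.ofReal_pow (by positivity), ← ENNReal.ofReal_mul (by positivity),
      ENNReal.one_le_ofReal, inv_pow, ← div_eq_inv_mul, one_le_div (pow_pos h1 d)] at h'
    exact h'
  have hdpow : (d : ℝ) ≤ 2 ^ d := by exact_mod_cast Nat.lt_two_pow_self.le
  have hbern : 1 - d * ε ≤ (1 - ε) ^ d := by
    have := one_add_mul_le_pow (a := -ε) (by linarith) d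
    rw [← sub_eq_add_neg] at this
    linarith
  -- Convexity of `t ↦ t ^ d` between `1` and `2`.
  have hconv : (1 + ε) ^ d ≤ 1 + 2 ^ d * ε := by
    have h := (convexOn_pow (𝕜 := ℝ) d).2 (show (1 : ℝ) ∈ Ici 0 by simp)
      (show (2 : ℝ) ∈ Ici 0 by simp) (show 0 ≤ 1 - ε by linarith) hε0 (by ring)
    simp only [smul_eq_mul, one_pow, mul_one] at h
    have e : 1 - ε + ε * 2 = 1 + ε := by ring
    rw [e] at h
    linarith
  rw [abs_le]
  constructor <;> nlinarith

end

section

variable {d : ℕ}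

/-! ### The Gaussian and its gradient -/

theorem gaussian_nonneg (u : Dom d) : 0 ≤ gaussian u := by
  unfold gaussian; positivity

theorem hasGradientAt_gaussian (u : Dom d) :
    HasGradientAt (gaussian (d := d)) (-(gaussian u) • u) u := by
  have h1 : HasFDerivAt (fun u : Dom d => ‖u‖ ^ 2) (2 • innerSL ℝ u) u :=
    (hasStrictFDerivAt_norm_sq u).hasFDerivAt
  have h2 := ((h1.neg.mul_const (2⁻¹ : ℝ)).exp).const_mul ((2 * Real.pi) ^ (-(d : ℝ) / 2))
  rw [hasGradientAt_iff_hasFDerivAt]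
  convert! h2 using 1
  ext v
  simp [gaussian, div_eq_mul_inv]
  ring

theorem gradient_gaussian (u : Dom d) : gradient (gaussian (d := d)) u = -(gaussian u) • u :=
  (hasGradientAt_gaussian u).gradient

theorem continuous_gaussian : Continuous (gaussian (d := d)) := by
  unfold gaussian; fun_prop

theorem continuous_gradient_gaussian : Continuous (gradient (gaussian (d := d))) := by
  have : gradient (gaussian (d := d)) = fun u => -(gaussian u) • u := funext gradient_gaussian
  rw [this]
  have := continuous_gaussian (d := d)
  fun_prop

theorem integrable_exp_neg_mul_sq_norm {b : ℝ} (hb : 0 < b) :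
    Integrable fun u : Dom d => Real.exp (-b * ‖u‖ ^ 2) := by
  have h := (GaussianFourier.integrable_cexp_neg_mul_sq_norm_add (V := Dom d) (b := (b : ℂ))
    (by simpa using hb) 0 0).norm
  refine h.congr (ae_of_all _ fun u => ?_)
  simp only [zero_mul, add_zero, Complex.norm_exp]
  congr 1
  norm_cast

theorem integral_gaussian : ∫ u : Dom d, gaussian u = 1 := by
  have h := GaussianFourier.integral_rexp_neg_mul_sq_norm (V := Dom d) (b := 1 / 2) (by norm_num)
  have e : ∀ u : Dom d, Real.exp (-‖u‖ ^ 2 / 2) = Real.exp (-(1 / 2) * ‖u‖ ^ 2) := fun u => by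
    congr 1; ring
  simp only [gaussian, integral_const_mul, e, h, finrank_euclideanSpace_fin]
  rw [show Real.pi / (1 / 2) = 2 * Real.pi by ring, ← Real.rpow_add (by positivity)]
  convert! Real.rpow_zero _ using 2
  ring

theorem integrable_gaussian : Integrable (gaussian (d := d)) := by
  by_contra h
  exact zero_ne_one ((integral_undef h).symm.trans integral_gaussian)

theorem lintegral_gaussian : ∫⁻ u : Dom d, ‖gaussian u‖ₑ = 1 := by
  rw [← ofReal_integral_norm_eq_lintegral_enorm integrable_gaussian]
  simp only [Real.norm_of_nonneg (gaussian_nonneg _), integral_gaussian, ENNReal.ofReal_one]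

theorem gaussian_le (u : Dom d) :
    gaussian u ≤ (2 * Real.pi) ^ (-(d : ℝ) / 2) * Real.exp (-(1 / 4) * ‖u‖ ^ 2) := by
  unfold gaussian
  gcongr
  nlinarith [sq_nonneg ‖u‖]

theorem norm_gradient_gaussian_le (u : Dom d) :
    ‖gradient (gaussian (d := d)) u‖ ≤
      (2 * Real.pi) ^ (-(d : ℝ) / 2) * Real.exp (-(1 / 4) * ‖u‖ ^ 2) := by
  rw [gradient_gaussian, norm_smul, norm_neg, Real.norm_of_nonneg (gaussian_nonneg u), gaussian,
    mul_assoc]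
  have h : ‖u‖ ≤ Real.exp (1 / 4 * ‖u‖ ^ 2) := by
    linarith [Real.add_one_le_exp (1 / 4 * ‖u‖ ^ 2), sq_nonneg (‖u‖ / 2 - 1)]
  gcongr
  calc Real.exp (-‖u‖ ^ 2 / 2) * ‖u‖
      ≤ Real.exp (-‖u‖ ^ 2 / 2) * Real.exp (1 / 4 * ‖u‖ ^ 2) := by gcongr
    _ = Real.exp (-(1 / 4) * ‖u‖ ^ 2) := by rw [← Real.exp_add]; congr 1; ring

theorem integrable_gradient_gaussian : Integrable (gradient (gaussian (d := d))) :=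
  ((integrable_exp_neg_mul_sq_norm (by norm_num)).const_mul _).mono'
    continuous_gradient_gaussian.aestronglyMeasurable (ae_of_all _ norm_gradient_gaussian_le)

theorem ofReal_translationConst :
    ENNReal.ofReal (translationConst d) = 2 ^ d * ∫⁻ u, ‖gradient (gaussian (d := d)) u‖ₑ := by
  rw [translationConst, ENNReal.ofReal_mul (by positivity),
    ofReal_integral_norm_eq_lintegral_enorm integrable_gradient_gaussian,
    ENNReal.ofReal_pow (by norm_num), ENNReal.ofReal_ofNat]

/-- The mean value inequality in averaged form. The average, unlike a supremum over the segment,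
yields the constant `‖∇h‖_{L¹}` in the bound of `L_τ A_s - A_s`. -/
theorem enorm_gaussian_sub_le (a b : Dom d) :
    ‖gaussian a - gaussian b‖ₑ ≤
      ‖a - b‖ₑ * ∫⁻ t in Ioc (0 : ℝ) 1, ‖gradient (gaussian (d := d)) (b + t • (a - b))‖ₑ := by
  have hline : ∀ t : ℝ, HasDerivAt (fun t : ℝ => b + t • (a - b)) (a - b) t := fun t => by
    simpa using ((hasDerivAt_id t).smul_const (a - b)).const_add b
  have hder : ∀ t : ℝ, HasDerivAt (fun t : ℝ => gaussian (b + t • (a - b)))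
      (inner ℝ (gradient (gaussian (d := d)) (b + t • (a - b))) (a - b)) t := fun t => by
    have h := (hasGradientAt_gaussian (b + t • (a - b))).hasFDerivAt.comp_hasDerivAt t (hline t)
    rw [← gradient_gaussian] at h
    convert! h using 1
  have hcont : Continuous fun t : ℝ => gradient (gaussian (d := d)) (b + t • (a - b)) :=
    continuous_gradient_gaussian.comp (by fun_prop)
  have hint := intervalIntegral.integral_eq_sub_of_hasDerivAt (a := 0) (b := 1)
    (fun t _ => hder t) ((hcont.inner continuous_const).intervalIntegrable 0 1)
  simp only [one_smul, zero_smul, add_zero, add_sub_cancel] at hint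
  rw [← hint, intervalIntegral.integral_of_le zero_le_one,
    ← lintegral_const_mul _ hcont.enorm.measurable]
  refine (enorm_integral_le_lintegral_enorm _).trans (lintegral_mono fun t => ?_)
  rw [mul_comm]
  simp only [← ofReal_norm]
  rw [← ENNReal.ofReal_mul (norm_nonneg _)]
  exact ENNReal.ofReal_le_ofReal (norm_inner_le_norm _ _)

/-! ### The Gaussian of scale `s` -/

theorem continuous_gaussianScale (s : ℝ) : Continuous (gaussianScale (d := d) s) :=
  (continuous_gaussian.comp (continuous_const_smul s⁻¹)).const_mul _

theorem enorm_gaussianScale_sub {s : ℝ} (hs : 0 < s) (a b : Dom d) :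
    ‖gaussianScale s a - gaussianScale s b‖ₑ =
      ENNReal.ofReal (s ^ d)⁻¹ * ‖gaussian (s⁻¹ • a) - gaussian (s⁻¹ • b)‖ₑ := by
  rw [gaussianScale, gaussianScale, ← mul_sub, enorm_mul, Real.enorm_of_nonneg (by positivity)]

theorem lintegral_gaussianScale {s : ℝ} (hs : 0 < s) :
    ∫⁻ u : Dom d, ‖gaussianScale s u‖ₑ = 1 := by
  have hm := (continuous_gaussian (d := d)).enorm.measurable
  have hms : Measurable fun u : Dom d => ‖gaussian (s⁻¹ • u)‖ₑ :=
    hm.comp (measurable_const_smul s⁻¹)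
  rw [← lintegral_gaussian (d := d), ← lintegral_comp_inv_smul hs hm, ← lintegral_const_mul _ hms]
  refine lintegral_congr fun u => ?_
  rw [gaussianScale, enorm_mul, Real.enorm_of_nonneg (by positivity)]

theorem memLp_gaussianScale_sub {s : ℝ} (hs : 0 < s) (u : Dom d) :
    MemLp (fun v => gaussianScale s (u - v)) 2 := by
  have hc : Continuous fun v => gaussianScale s (u - v) :=
    (continuous_gaussianScale s).comp (by fun_prop)
  rw [memLp_two_iff_integrable_sq hc.aestronglyMeasurable]
  have h1 := (((integrable_exp_neg_mul_sq_norm (d := d) one_pos).comp_smul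
    (inv_ne_zero hs.ne')).comp_sub_left u).const_mul
      ((s ^ d)⁻¹ ^ 2 * ((2 * Real.pi) ^ (-(d : ℝ) / 2)) ^ 2)
  refine h1.congr (ae_of_all _ fun v => ?_)
  simp only [gaussianScale, gaussian, mul_pow, ← Real.exp_nat_mul]
  rw [mul_assoc]
  congr 3
  push_cast
  ring

end

section

variable {d p : ℕ}

/-! ### Deformations -/

section Deformation

variable {τ : Dom d → Dom d}

theorem antilipschitz_id_sub (h : ∀ x y, ‖τ x - τ y‖ ≤ 1 / 2 * ‖x - y‖) :
    AntilipschitzWith 2 fun u => u - τ u := by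
  refine AntilipschitzWith.of_le_mul_dist fun x y => ?_
  rw [dist_eq_norm, dist_eq_norm, sub_sub_sub_comm]
  push_cast
  linarith [norm_sub_norm_le (x - y) (τ x - τ y), h x y]

theorem surjective_id_sub (h : ∀ x y, ‖τ x - τ y‖ ≤ 1 / 2 * ‖x - y‖) :
    Surjective fun u => u - τ u := fun w => by
  have hc : ContractingWith (1 / 2) fun v => w + τ v :=
    ⟨by norm_num, LipschitzWith.of_dist_le_mul fun x y => by
      rw [dist_eq_norm, dist_eq_norm, add_sub_add_left_eq_sub]
      exact_mod_cast h x y⟩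
  have hfix : w + τ (hc.fixedPoint _) = hc.fixedPoint _ := hc.fixedPoint_isFixedPt
  exact ⟨hc.fixedPoint _, (eq_sub_of_add_eq hfix).symm⟩

theorem norm_fderiv_le_gradSupNorm (hgrad : ∀ u, ‖fderiv ℝ τ u‖ ≤ 1 / 2) (u : Dom d) :
    ‖fderiv ℝ τ u‖ ≤ gradSupNorm τ :=
  le_ciSup (f := fun u => ‖fderiv ℝ τ u‖) ⟨1 / 2, by rintro _ ⟨u, rfl⟩; exact hgrad u⟩ u

theorem gradSupNorm_le (hgrad : ∀ u, ‖fderiv ℝ τ u‖ ≤ 1 / 2) : gradSupNorm τ ≤ 1 / 2 :=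
  ciSup_le hgrad

theorem gradSupNorm_nonneg (τ : Dom d → Dom d) : 0 ≤ gradSupNorm τ :=
  Real.iSup_nonneg fun _ => norm_nonneg _

theorem norm_sub_le_gradSupNorm (hτ : ContDiff ℝ 1 τ) (hgrad : ∀ u, ‖fderiv ℝ τ u‖ ≤ 1 / 2)
    (x y : Dom d) : ‖τ x - τ y‖ ≤ gradSupNorm τ * ‖x - y‖ :=
  convex_univ.norm_image_sub_le_of_norm_fderiv_le (𝕜 := ℝ)
    (fun u _ => (hτ.differentiable one_ne_zero) u)
    (fun u _ => norm_fderiv_le_gradSupNorm hgrad u) (mem_univ y) (mem_univ x)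

theorem norm_sub_le_half (hτ : ContDiff ℝ 1 τ) (hgrad : ∀ u, ‖fderiv ℝ τ u‖ ≤ 1 / 2)
    (x y : Dom d) : ‖τ x - τ y‖ ≤ 1 / 2 * ‖x - y‖ :=
  (norm_sub_le_gradSupNorm hτ hgrad x y).trans (by gcongr; exact gradSupNorm_le hgrad)

/-- The square root of `2 ^ d` would do; the weaker factor `2 ^ d` keeps the constants free of
roots. -/
theorem eLpNorm_comp_le_of_antilipschitz {E : Type*} [NormedAddCommGroup E] {ξ : Dom d → Dom d}
    (hξ : AntilipschitzWith 2 ξ) (hm : Measurable ξ) {z : Dom d → E} (hz : StronglyMeasurable z) :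
    eLpNorm (fun u => z (ξ u)) 2 ≤ 2 ^ d * eLpNorm z 2 := by
  rw [eLpNorm_two_le_iff, mul_pow, eLpNorm_two_sq]
  refine (lintegral_comp_le_of_antilipschitz hξ hm (hz.enorm.pow_const 2)).trans ?_
  have h2 : (1 : ℝ≥0∞) ≤ 2 ^ d := one_le_pow₀ (by norm_num)
  rw [ENNReal.coe_ofNat]
  exact mul_le_mul_left (le_self_pow₀ h2 two_ne_zero) _

end Deformation

/-! ### Pooling -/

variable {s : ℝ} {z : Dom d → Chan p}

theorem stronglyMeasurable_pool (s : ℝ) (hz : StronglyMeasurable z) :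
    StronglyMeasurable (pool s z) := by
  refine StronglyMeasurable.integral_prod_right
    (f := fun u v : Dom d => gaussianScale s (u - v) • z v) ?_
  exact ((continuous_gaussianScale s).comp (by fun_prop : Continuous fun q : Dom d × Dom d =>
    q.1 - q.2)).stronglyMeasurable.smul (hz.comp_measurable measurable_snd)

theorem integrable_gaussianScale_smul (hs : 0 < s) (hz : MemLp z 2) (u : Dom d) :
    Integrable fun v => gaussianScale s (u - v) • z v :=
  memLp_one_iff_integrable.1 (hz.smul (memLp_gaussianScale_sub hs u))

theorem pool_sub (hs : 0 < s) {z' : Dom d → Chan p} (hz : MemLp z 2) (hz' : MemLp z' 2) :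
    pool s (z - z') = pool s z - pool s z' := by
  ext1 u
  simp only [pool, Pi.sub_apply, smul_sub]
  exact integral_sub (integrable_gaussianScale_smul hs hz u)
    (integrable_gaussianScale_smul hs hz' u)

/-- Schur's test for a kernel which is dominated by a convolution kernel. -/
theorem eLpNorm_le_of_convolution_kernel {E F : Type*} [NormedAddCommGroup E]
    [NormedAddCommGroup F] {g : Dom d → ℝ≥0∞} (hg : Measurable g) {f : Dom d → E} {G : Dom d → F}
    (hf : StronglyMeasurable f) (hG : ∀ u, ‖G u‖ₑ ≤ ∫⁻ v, g (u - v) * ‖f v‖ₑ) :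
    eLpNorm G 2 ≤ (∫⁻ w, g w) * eLpNorm f 2 := by
  refine eLpNorm_le_of_kernel (k := fun u v => g (u - v)) ?_ hf.enorm hG ?_ ?_
  · exact hg.comp (measurable_fst.sub measurable_snd)
  · exact fun u => (lintegral_sub_left_eq_self g u).le
  · exact fun v => (lintegral_sub_right_eq_self g v).le

theorem eLpNorm_pool_le (hs : 0 < s) (hz : StronglyMeasurable z) :
    eLpNorm (pool s z) 2 ≤ eLpNorm z 2 := by
  have h := eLpNorm_le_of_convolution_kernel (g := fun w => ‖gaussianScale s w‖ₑ)
    (G := pool s z) (continuous_gaussianScale s).enorm.measurable hz fun u => by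
      simp only [← enorm_smul]
      exact enorm_integral_le_lintegral_enorm _
  rwa [lintegral_gaussianScale hs, one_mul] at h

theorem memLp_pool (hs : 0 < s) (hz : StronglyMeasurable z) (hz2 : MemLp z 2) :
    MemLp (pool s z) 2 :=
  ⟨(stronglyMeasurable_pool s hz).aestronglyMeasurable, (eLpNorm_pool_le hs hz).trans_lt hz2.2⟩

/-- `L_τ A_s - A_s` is bounded by `2 ^ d ‖∇h‖_{L¹} ‖τ‖_∞ / s`: the kernel is an average over
`t ∈ [0, 1]` of kernels `∇h_s (u - t τ(u) - v) · τ(u)`, whose column integrals are controlled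
because `u ↦ u - t τ(u)` contracts volumes at most by the factor `2 ^ d`. -/
theorem eLpNorm_pool_comp_sub_pool_le {τ : Dom d → Dom d} (hs : 0 < s)
    (hτ : Continuous τ) (hbdd : BddAbove (range fun u => ‖τ u‖))
    (hhalf : ∀ x y, ‖τ x - τ y‖ ≤ 1 / 2 * ‖x - y‖)
    (hz : StronglyMeasurable z) (hz2 : MemLp z 2) :
    eLpNorm (fun u => pool s z (u - τ u) - pool s z u) 2 ≤
      ENNReal.ofReal (translationConst d / s * supNorm τ) * eLpNorm z 2 := by
  set T := ENNReal.ofReal (supNorm τ / s) with hT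
  set G : Dom d → ℝ≥0∞ := fun w => ‖gradient (gaussian (d := d)) w‖ₑ with hGdef
  have hG : Measurable G := continuous_gradient_gaussian.enorm.measurable
  have hsup0 : 0 ≤ supNorm τ := Real.iSup_nonneg fun _ => norm_nonneg _
  have hconst : ENNReal.ofReal (translationConst d / s * supNorm τ) = T * (2 ^ d * ∫⁻ w, G w) := by
    rw [← ofReal_translationConst, ← ENNReal.ofReal_mul (by positivity)]
    congr 1; ring
  -- The gradient kernel at the intermediate point of parameter `t`.
  let φ : Dom d → Dom d → ℝ → ℝ≥0∞ := fun u v t => G (s⁻¹ • (u - t • τ u - v))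
  have hφ : Measurable fun q : (Dom d × Dom d) × ℝ => φ q.1.1 q.1.2 q.2 :=
    hG.comp (by fun_prop : Continuous fun q : (Dom d × Dom d) × ℝ =>
      s⁻¹ • (q.1.1 - q.2 • τ q.1.1 - q.1.2)).measurable
  have hsm : Measurable fun w : Dom d => G (s⁻¹ • w) := hG.comp (measurable_const_smul s⁻¹)
  have hscale := lintegral_comp_inv_smul hs hG
  let k : Dom d → Dom d → ℝ≥0∞ := fun u v =>
    ENNReal.ofReal (s ^ d)⁻¹ * (T * ∫⁻ t in Ioc (0 : ℝ) 1, φ u v t)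
  have hker : ∀ u v, ‖gaussianScale s (u - τ u - v) - gaussianScale s (u - v)‖ₑ ≤ k u v := by
    intro u v
    rw [enorm_gaussianScale_sub hs]
    simp only [k]
    gcongr
    refine (enorm_gaussian_sub_le _ _).trans ?_
    gcongr with t
    · rw [← smul_sub, ← ofReal_norm, norm_smul, norm_inv, Real.norm_of_nonneg hs.le,
        ← div_eq_inv_mul]
      refine ENNReal.ofReal_le_ofReal ?_
      have : u - τ u - v - (u - v) = -τ u := by abel
      rw [this, norm_neg]
      gcongr
      exact le_ciSup hbdd u
    · simp only [φ, hGdef, ← smul_sub]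
      refine le_of_eq ?_
      congr 2
      rw [smul_comm t, ← smul_add]
      congr 1
      rw [show u - τ u - v - (u - v) = -τ u by abel, smul_neg]
      abel
  rw [hconst]
  have hrest : ∀ c : ℝ≥0∞, ∫⁻ _ in Ioc (0 : ℝ) 1, c = c := fun c => by simp
  refine eLpNorm_le_of_kernel (k := k) ?_ hz.enorm (fun u => ?_) (fun u => ?_) (fun v => ?_)
  · exact ((Measurable.lintegral_prod_right' (ν := volume.restrict (Ioc (0 : ℝ) 1))
      hφ).const_mul _).const_mul _
  · have e : pool s z (u - τ u) - pool s z u =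
        ∫ v, (gaussianScale s (u - τ u - v) - gaussianScale s (u - v)) • z v := by
      simp only [pool, sub_smul]
      exact (integral_sub (integrable_gaussianScale_smul hs hz2 _)
        (integrable_gaussianScale_smul hs hz2 _)).symm
    rw [e]
    refine (enorm_integral_le_lintegral_enorm _).trans (lintegral_mono fun v => ?_)
    rw [enorm_smul]
    gcongr
    exact hker u v
  · have hm : Measurable fun q : Dom d × ℝ => φ u q.1 q.2 :=
      hφ.comp (f := fun q : Dom d × ℝ => ((u, q.1), q.2)) (by fun_prop)
    have hmi : Measurable fun v => ∫⁻ t in Ioc (0 : ℝ) 1, φ u v t :=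
      Measurable.lintegral_prod_right' (ν := volume.restrict (Ioc (0 : ℝ) 1)) hm
    simp only [k]
    rw [lintegral_const_mul _ (hmi.const_mul _), lintegral_const_mul _ hmi,
      lintegral_lintegral_swap hm.aemeasurable]
    have : ∀ t, ∫⁻ v, φ u v t = ∫⁻ w : Dom d, G (s⁻¹ • w) := fun t =>
      lintegral_sub_left_eq_self (fun w => G (s⁻¹ • w)) (u - t • τ u)
    simp only [this, hrest]
    rw [mul_left_comm, hscale]
    gcongr
    exact le_mul_of_one_le_left' (one_le_pow₀ (by norm_num))
  · have hm : Measurable fun q : Dom d × ℝ => φ q.1 v q.2 :=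
      hφ.comp (f := fun q : Dom d × ℝ => ((q.1, v), q.2)) (by fun_prop)
    have hmi : Measurable fun u => ∫⁻ t in Ioc (0 : ℝ) 1, φ u v t :=
      Measurable.lintegral_prod_right' (ν := volume.restrict (Ioc (0 : ℝ) 1)) hm
    simp only [k]
    rw [lintegral_const_mul _ (hmi.const_mul _), lintegral_const_mul _ hmi,
      lintegral_lintegral_swap hm.aemeasurable]
    have hle : ∀ t ∈ Ioc (0 : ℝ) 1, ∫⁻ u, φ u v t ≤ 2 ^ d * ∫⁻ w : Dom d, G (s⁻¹ • w) := by
      intro t ht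
      have hanti : AntilipschitzWith 2 fun u => u - t • τ u :=
        antilipschitz_id_sub (τ := fun u => t • τ u) fun x y => by
          rw [← smul_sub, norm_smul, Real.norm_of_nonneg ht.1.le]
          exact (mul_le_of_le_one_left (norm_nonneg _) ht.2).trans (hhalf x y)
      have h := lintegral_comp_le_of_antilipschitz hanti
        (by fun_prop : Continuous fun u => u - t • τ u).measurable
        (f := fun w => G (s⁻¹ • (w - v))) (hsm.comp (measurable_id.sub_const v))
      rw [lintegral_sub_right_eq_self fun w => G (s⁻¹ • w)] at h
      exact_mod_cast h
    calc _ ≤ ENNReal.ofReal (s ^ d)⁻¹ * (T * ∫⁻ _ in Ioc (0 : ℝ) 1,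
          2 ^ d * ∫⁻ w : Dom d, G (s⁻¹ • w)) := by
          exact mul_le_mul_right (mul_le_mul_right (setLIntegral_mono measurable_const hle) _) _
      _ = _ := by
          rw [hrest, ← hscale]
          ring

end

section

variable {d p : ℕ}

/-! ### The commutator of pooling and deformation -/

/-- The amplitude of a Gaussian which dominates, up to the factor `‖∇τ‖_∞`, the kernel of the
commutator of pooling and deformation on the patches of relative size `κ`. -/
noncomputable def envelopeAmplitude (d : ℕ) (κ : ℝ) : ℝ :=
  (2 * Real.pi) ^ (-(d : ℝ) / 2) * Real.exp (κ ^ 2 / 4) * (2 ^ d + 16)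

/-- The constant in the bound of the commutator of pooling and deformation: the integral of the
dominating Gaussian, times the bound `2 ^ d` of the norm of a deformation. -/
noncomputable def commutatorConst (d : ℕ) (κ : ℝ) : ℝ :=
  2 ^ d * ∫ w : Dom d, envelopeAmplitude d κ * Real.exp (-(1 / 64) * ‖w‖ ^ 2)

theorem commutatorConst_nonneg (d : ℕ) (κ : ℝ) : 0 ≤ commutatorConst d κ :=
  mul_nonneg (by positivity) (integral_nonneg fun w => by
    simp only [envelopeAmplitude]; positivity)

/-- A point at distance at most `|w| / 2` from `w + c`, with `|c| ≤ κ`, has norm at least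
`|w| / 2 - κ`, so that a Gaussian there is at most a wider Gaussian at `w`. -/
theorem exp_le_of_norm_sub_le {κ : ℝ} {w c y : Dom d} (hc : ‖c‖ ≤ κ)
    (hy : ‖w + c - y‖ ≤ 1 / 2 * ‖w‖) :
    Real.exp (-(1 / 4) * ‖y‖ ^ 2) ≤ Real.exp (κ ^ 2 / 4) * Real.exp (-(1 / 32) * ‖w‖ ^ 2) := by
  have h : 1 / 2 * ‖w‖ ≤ ‖y‖ + κ := by
    have h1 : w = (w + c - y) + (y - c) := by abel
    have h2 : ‖w‖ ≤ ‖w + c - y‖ + ‖y - c‖ := by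
      conv_lhs => rw [h1]
      exact norm_add_le _ _
    linarith [norm_sub_le y c]
  rw [← Real.exp_add]
  refine Real.exp_le_exp.2 ?_
  have h0 := norm_nonneg w
  have h3 : (1 / 2 * ‖w‖) ^ 2 ≤ (‖y‖ + κ) ^ 2 := by gcongr
  nlinarith [sq_nonneg (‖y‖ - κ)]

theorem abs_gaussian_sub_mul_le {κ ε J : ℝ} {w c δ : Dom d} (hc : ‖c‖ ≤ κ) (hε : ε ≤ 1 / 2)
    (hε0 : 0 ≤ ε) (hδ : ‖δ‖ ≤ ε * ‖w‖) (hJ : |1 - J| ≤ 2 ^ d * ε) :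
    |gaussian (w + c) - J * gaussian (w + c - δ)| ≤
      ε * (envelopeAmplitude d κ * Real.exp (-(1 / 64) * ‖w‖ ^ 2)) := by
  set a := (2 * Real.pi) ^ (-(d : ℝ) / 2) with ha
  have ha0 : 0 ≤ a := by positivity
  set M := a * (Real.exp (κ ^ 2 / 4) * Real.exp (-(1 / 32) * ‖w‖ ^ 2)) with hM
  have hM0 : 0 ≤ M := by positivity
  have hδ' : ‖δ‖ ≤ 1 / 2 * ‖w‖ := hδ.trans (by gcongr)
  have h1 : gaussian (w + c - δ) ≤ M := (gaussian_le _).trans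
    (mul_le_mul_of_nonneg_left (exp_le_of_norm_sub_le hc (by simpa using hδ')) ha0)
  have h2 : |gaussian (w + c - δ) - gaussian (w + c)| ≤ M * ‖δ‖ := by
    have hconv := (convex_segment (w + c) (w + c - δ)).norm_image_sub_le_of_norm_fderiv_le
      (𝕜 := ℝ) (f := gaussian (d := d)) (C := M)
      (fun y _ => (hasGradientAt_gaussian y).differentiableAt) (fun y hy => ?_)
      (left_mem_segment ℝ _ _) (right_mem_segment ℝ _ _)
    · simpa using hconv
    · have hn : ‖fderiv ℝ (gaussian (d := d)) y‖ = ‖gradient (gaussian (d := d)) y‖ := by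
        simp [gradient]
      rw [hn]
      refine (norm_gradient_gaussian_le y).trans ?_
      have hyd : ‖w + c - y‖ ≤ 1 / 2 * ‖w‖ := by
        obtain ⟨t, ⟨ht0, ht1⟩, rfl⟩ := (segment_eq_image' ℝ (w + c) (w + c - δ)) ▸ hy
        have : w + c - (w + c + t • (w + c - δ - (w + c))) = t • δ := by
          rw [show w + c - δ - (w + c) = -δ by abel, smul_neg]; abel
        rw [this, norm_smul, Real.norm_of_nonneg ht0]
        exact (mul_le_of_le_one_left (norm_nonneg _) ht1).trans hδ'
      exact mul_le_mul_of_nonneg_left (exp_le_of_norm_sub_le hc hyd) ha0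
  have h3 : ‖w‖ * Real.exp (-(1 / 32) * ‖w‖ ^ 2) ≤ 16 * Real.exp (-(1 / 64) * ‖w‖ ^ 2) := by
    have h : ‖w‖ ≤ 16 * Real.exp (1 / 64 * ‖w‖ ^ 2) := by
      linarith [Real.add_one_le_exp (1 / 64 * ‖w‖ ^ 2), sq_nonneg (‖w‖ / 2 - 1)]
    calc ‖w‖ * Real.exp (-(1 / 32) * ‖w‖ ^ 2)
        ≤ 16 * Real.exp (1 / 64 * ‖w‖ ^ 2) * Real.exp (-(1 / 32) * ‖w‖ ^ 2) := by gcongr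
      _ = 16 * Real.exp (-(1 / 64) * ‖w‖ ^ 2) := by
        rw [mul_assoc, ← Real.exp_add]; congr 2; ring
  have h4 : Real.exp (-(1 / 32) * ‖w‖ ^ 2) ≤ Real.exp (-(1 / 64) * ‖w‖ ^ 2) :=
    Real.exp_le_exp.2 (by nlinarith [sq_nonneg ‖w‖])
  have e : gaussian (w + c) - J * gaussian (w + c - δ) =
      (1 - J) * gaussian (w + c - δ) - (gaussian (w + c - δ) - gaussian (w + c)) := by ring
  calc |gaussian (w + c) - J * gaussian (w + c - δ)|
      ≤ |1 - J| * gaussian (w + c - δ) + |gaussian (w + c - δ) - gaussian (w + c)| := by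
        rw [e]
        refine (abs_sub _ _).trans_eq ?_
        rw [abs_mul, abs_of_nonneg (gaussian_nonneg (w + c - δ))]
    _ ≤ 2 ^ d * ε * M + M * (ε * ‖w‖) := by
        have := gaussian_nonneg (w + c - δ)
        gcongr
        exact h2.trans (by gcongr)
    _ = ε * (a * Real.exp (κ ^ 2 / 4) * (2 ^ d * Real.exp (-(1 / 32) * ‖w‖ ^ 2) +
          ‖w‖ * Real.exp (-(1 / 32) * ‖w‖ ^ 2))) := by rw [hM]; ring
    _ ≤ ε * (a * Real.exp (κ ^ 2 / 4) * (2 ^ d * Real.exp (-(1 / 64) * ‖w‖ ^ 2) +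
          16 * Real.exp (-(1 / 64) * ‖w‖ ^ 2))) := by gcongr
    _ = _ := by rw [envelopeAmplitude]; ring

/-- The change of variables `w = v - τ(v)` in the integral defining `A_s z`. -/
theorem pool_eq_integral_comp {s : ℝ} (hs : 0 < s) {z : Dom d → Chan p} (hz2 : MemLp z 2)
    {τ : Dom d → Dom d} (hτ : ContDiff ℝ 1 τ)
    (hhalf : ∀ x y, ‖τ x - τ y‖ ≤ 1 / 2 * ‖x - y‖) (a : Dom d) :
    let k := fun v => |(ContinuousLinearMap.id ℝ (Dom d) - fderiv ℝ τ v).det| •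
      (gaussianScale s (a - (v - τ v)) • z (v - τ v))
    Integrable k ∧ pool s z a = ∫ v, k v := by
  have hder : ∀ v ∈ (univ : Set (Dom d)), HasFDerivWithinAt (fun v => v - τ v)
      (ContinuousLinearMap.id ℝ (Dom d) - fderiv ℝ τ v) univ v := fun v _ =>
    ((hasFDerivAt_id v).sub ((hτ.differentiable one_ne_zero) v).hasFDerivAt).hasFDerivWithinAt
  have hinj : InjOn (fun v => v - τ v) univ := (antilipschitz_id_sub hhalf).injective.injOn
  have himg : (fun v => v - τ v) '' univ = univ := by
    rw [image_univ, (surjective_id_sub hhalf).range_eq]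
  have h1 := integral_image_eq_integral_abs_det_fderiv_smul volume MeasurableSet.univ hder hinj
    fun w => gaussianScale s (a - w) • z w
  have h2 := integrableOn_image_iff_integrableOn_abs_det_fderiv_smul volume MeasurableSet.univ
    hder hinj fun w => gaussianScale s (a - w) • z w
  rw [himg, setIntegral_univ, setIntegral_univ] at h1
  rw [himg, integrableOn_univ, integrableOn_univ] at h2
  exact ⟨h2.1 (integrable_gaussianScale_smul hs hz2 a), h1⟩

/-- The commutator `[L_c A_s, L_τ]` of a translated pooling operator and a deformation is bounded
by `C ‖∇τ‖_∞`. After the change of variables `v ↦ v - τ(v)` in the second term it is an integral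
operator applied to `L_τ z`, whose kernel vanishes to first order in `∇τ`. -/
theorem eLpNorm_pool_warp_sub_le {s κ : ℝ} (hs : 0 < s) {z : Dom d → Chan p}
    (hz : StronglyMeasurable z) (hz2 : MemLp z 2) {τ : Dom d → Dom d} (hτ : ContDiff ℝ 1 τ)
    (hgrad : ∀ u, ‖fderiv ℝ τ u‖ ≤ 1 / 2) {c : Dom d} (hc : ‖c‖ ≤ κ * s) :
    eLpNorm (fun u => pool s (warp τ z) (u + c) - pool s z (u - τ u + c)) 2 ≤
      ENNReal.ofReal (commutatorConst d κ * gradSupNorm τ) * eLpNorm z 2 := by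
  set ε := gradSupNorm τ with hεdef
  have hε : ε ≤ 1 / 2 := gradSupNorm_le hgrad
  have hε0 : 0 ≤ ε := gradSupNorm_nonneg τ
  have hlip := norm_sub_le_gradSupNorm hτ hgrad
  have hhalf := norm_sub_le_half hτ hgrad
  have hanti := antilipschitz_id_sub hhalf
  have hξm : Measurable fun u => u - τ u := (continuous_id.sub hτ.continuous).measurable
  set Q : Dom d → ℝ := fun w => envelopeAmplitude d κ * Real.exp (-(1 / 64) * ‖w‖ ^ 2) with hQ
  have hQ0 : ∀ w, 0 ≤ Q w := fun w => by simp only [hQ, envelopeAmplitude]; positivity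
  have hQm : Measurable fun w => ENNReal.ofReal (Q w) := by simp only [hQ]; fun_prop
  have hQi : Integrable Q := (integrable_exp_neg_mul_sq_norm (by norm_num)).const_mul _
  have hsm : Measurable fun w : Dom d => ENNReal.ofReal (Q (s⁻¹ • w)) :=
    hQm.comp (measurable_const_smul s⁻¹)
  have hwarp : StronglyMeasurable (warp τ z) := hz.comp_measurable hξm
  have hwarp_le : eLpNorm (warp τ z) 2 ≤ 2 ^ d * eLpNorm z 2 :=
    eLpNorm_comp_le_of_antilipschitz hanti hξm hz
  have hwarp2 : MemLp (warp τ z) 2 := ⟨hwarp.aestronglyMeasurable,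
    hwarp_le.trans_lt (ENNReal.mul_lt_top (ENNReal.pow_lt_top (by simp)) hz2.2)⟩
  -- The dominating convolution kernel, of scale `s`.
  let g : Dom d → ℝ≥0∞ := fun w =>
    ENNReal.ofReal ε * (ENNReal.ofReal (s ^ d)⁻¹ * ENNReal.ofReal (Q (s⁻¹ • w)))
  have hg : Measurable g := (hsm.const_mul _).const_mul _
  have hgint : ∫⁻ w, g w = ENNReal.ofReal ε * ENNReal.ofReal (∫ w, Q w) := by
    simp only [g]
    rw [lintegral_const_mul _ (hsm.const_mul _), lintegral_const_mul _ hsm,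
      lintegral_comp_inv_smul hs hQm, ofReal_integral_eq_lintegral_ofReal hQi (ae_of_all _ hQ0)]
  have hker : ∀ u v, ‖gaussianScale s (u + c - v) -
      |(ContinuousLinearMap.id ℝ (Dom d) - fderiv ℝ τ v).det| *
        gaussianScale s (u - τ u + c - (v - τ v))‖ₑ ≤ g (u - v) := by
    intro u v
    set J := |(ContinuousLinearMap.id ℝ (Dom d) - fderiv ℝ τ v).det| with hJ
    have hJ' : |1 - J| ≤ 2 ^ d * ε :=
      abs_det_id_sub_bounds (norm_fderiv_le_gradSupNorm hgrad v) hε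
    have hc' : ‖s⁻¹ • c‖ ≤ κ := by
      rw [norm_smul, norm_inv, Real.norm_of_nonneg hs.le, ← div_eq_inv_mul, div_le_iff₀ hs]
      exact hc
    have hδ : ‖s⁻¹ • (τ u - τ v)‖ ≤ ε * ‖s⁻¹ • (u - v)‖ := by
      rw [norm_smul, norm_smul, mul_left_comm]
      gcongr
      exact hlip u v
    have h := abs_gaussian_sub_mul_le hc' hε hε0 hδ hJ'
    have e1 : u + c - v = (u - v) + c := by abel
    have e2 : u - τ u + c - (v - τ v) = (u - v) + c - (τ u - τ v) := by abel
    rw [← smul_add, ← smul_sub] at h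
    have e3 : gaussianScale s (u + c - v) - J * gaussianScale s (u - τ u + c - (v - τ v)) =
        (s ^ d)⁻¹ * (gaussian (s⁻¹ • (u - v + c)) -
          J * gaussian (s⁻¹ • (u - v + c - (τ u - τ v)))) := by
      rw [e1, e2, gaussianScale, gaussianScale]; ring
    rw [e3, enorm_mul, Real.enorm_of_nonneg (by positivity)]
    simp only [g]
    rw [mul_left_comm, ← ENNReal.ofReal_mul hε0, ← ofReal_norm (_ - _)]
    gcongr
    exact h
  have hmain := eLpNorm_le_of_convolution_kernel (f := warp τ z)
    (G := fun u => pool s (warp τ z) (u + c) - pool s z (u - τ u + c)) hg hwarp fun u => by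
      obtain ⟨hi, he⟩ := pool_eq_integral_comp hs hz2 hτ hhalf (u - τ u + c)
      rw [he, pool, ← integral_sub (integrable_gaussianScale_smul hs hwarp2 _) hi]
      refine (enorm_integral_le_lintegral_enorm _).trans (lintegral_mono fun v => ?_)
      simp only [smul_smul]
      change ‖_ • z (v - τ v) - _ • z (v - τ v)‖ₑ ≤ _ * ‖z (v - τ v)‖ₑ
      rw [← sub_smul, enorm_smul]
      gcongr
      exact hker u v
  refine hmain.trans ((mul_le_mul_right hwarp_le _).trans_eq ?_)
  rw [hgint, commutatorConst, ENNReal.ofReal_mul (by have := integral_nonneg (μ := volume) (f := Q) hQ0; positivity),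
    ENNReal.ofReal_mul (by positivity), ENNReal.ofReal_pow (by norm_num), ENNReal.ofReal_ofNat]
  ring

end

section

variable {d p q : ℕ}

/-! ### Patches and filters -/

theorem ae_mem_patchMeasure {S : Set (Dom d)} (hS : IsCompact S) :
    ∀ᵐ v ∂patchMeasure S, v ∈ S :=
  ProbabilityTheory.ae_cond_mem hS.measurableSet

theorem isProbabilityMeasure_patchMeasure {S : Set (Dom d)} (hS : IsCompact S)
    (hpos : 0 < volume S) : IsProbabilityMeasure (patchMeasure S) :=
  ProbabilityTheory.cond_isProbabilityMeasure_of_finite hpos.ne' hS.measure_lt_top.ne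

theorem spectralNorm_nonneg {S : Set (Dom d)} (W : FilterBank S q p) : 0 ≤ spectralNorm W := by
  rw [spectralNorm_eq]; exact norm_nonneg _

theorem applyFilters_eq_filterCLM {S : Set (Dom d)} (W : FilterBank S q p) {z : Dom d → Chan q}
    (hz : MemLp z 2 (patchMeasure S)) : applyFilters W z = filterCLM W hz.toLp := by
  rw [filterCLM_apply]
  ext i
  simp only [applyFilters]
  refine integral_congr_ae ?_
  filter_upwards [hz.coeFn_toLp] with v hv
  rw [hv]

theorem norm_patchMap_sub_le_norm {S : Set (Dom d)} {ρ : ℝ≥0} {σ : ℝ → ℝ} (hσ : LipschitzWith ρ σ)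
    (W : FilterBank S q p) (z₁ z₂ : Dom d → Chan q) :
    ‖patchMap σ W z₁ - patchMap σ W z₂‖ ≤ ρ * ‖applyFilters W z₁ - applyFilters W z₂‖ := by
  rw [EuclideanSpace.norm_eq, EuclideanSpace.norm_eq, ← Real.sqrt_sq ρ.coe_nonneg,
    ← Real.sqrt_mul (sq_nonneg _), Finset.mul_sum]
  refine Real.sqrt_le_sqrt (Finset.sum_le_sum fun i _ => ?_)
  rw [← mul_pow]
  have h := hσ.dist_le_mul (applyFilters W z₁ i) (applyFilters W z₂ i)
  rw [Real.dist_eq, Real.dist_eq] at h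
  exact pow_le_pow_left₀ (norm_nonneg _) h 2

theorem enorm_patchMap_sub_le {S : Set (Dom d)} {ρ : ℝ≥0} {σ : ℝ → ℝ} (hσ : LipschitzWith ρ σ)
    (W : FilterBank S q p) {z₁ z₂ : Dom d → Chan q} (h₁ : MemLp z₁ 2 (patchMeasure S))
    (h₂ : MemLp z₂ 2 (patchMeasure S)) :
    ‖patchMap σ W z₁ - patchMap σ W z₂‖ₑ ≤
      ENNReal.ofReal (ρ * spectralNorm W) * eLpNorm (z₁ - z₂) 2 (patchMeasure S) := by
  have h : ‖patchMap σ W z₁ - patchMap σ W z₂‖ ≤ ρ * spectralNorm W * ‖(h₁.sub h₂).toLp‖ := by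
    refine (norm_patchMap_sub_le_norm hσ W z₁ z₂).trans ?_
    rw [mul_assoc, spectralNorm_eq, applyFilters_eq_filterCLM W h₁, applyFilters_eq_filterCLM W h₂,
      ← map_sub, ← MemLp.toLp_sub]
    gcongr
    exact (filterCLM W).le_opNorm _
  rw [← ofReal_norm]
  refine (ENNReal.ofReal_le_ofReal h).trans_eq ?_
  rw [ENNReal.ofReal_mul (mul_nonneg ρ.coe_nonneg (spectralNorm_nonneg W)), Lp.norm_toLp,
    ENNReal.ofReal_toReal (h₁.sub h₂).2.ne]

theorem patchMap_zero {S : Set (Dom d)} {σ : ℝ → ℝ} (hσ0 : σ 0 = 0) (W : FilterBank S q p) :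
    patchMap σ W 0 = 0 := by
  ext i
  simp [patchMap, applyFilters, hσ0]

/-- Square integrable signals have square integrable patches, at almost every point. -/
theorem ae_memLp_patch {S : Set (Dom d)} [IsProbabilityMeasure (patchMeasure S)]
    {z : Dom d → Chan q} (hz : StronglyMeasurable z) (hz2 : MemLp z 2) :
    ∀ᵐ u, MemLp (patch z u) 2 (patchMeasure S) := by
  have hm : Measurable fun r : Dom d × Dom d => ‖z (r.1 + r.2)‖ₑ ^ 2 :=
    (hz.comp_measurable (measurable_fst.add measurable_snd)).enorm.pow_const 2
  have hfin : ∫⁻ u, ∫⁻ v, ‖z (u + v)‖ₑ ^ 2 ∂patchMeasure S ≠ ∞ := by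
    rw [lintegral_lintegral_swap hm.aemeasurable]
    have e : ∀ v, ∫⁻ u, ‖z (u + v)‖ₑ ^ 2 = eLpNorm z 2 ^ 2 := fun v => by
      rw [lintegral_add_right_eq_self (fun u => ‖z u‖ₑ ^ 2) v, eLpNorm_two_sq]
    simp only [e, lintegral_const, measure_univ, mul_one]
    exact ENNReal.pow_ne_top hz2.2.ne
  filter_upwards [ae_lt_top (Measurable.lintegral_prod_right' (ν := patchMeasure S) hm) hfin]
    with u hu
  refine ⟨(hz.comp_measurable (measurable_const_add u)).aestronglyMeasurable, ?_⟩
  change ∫⁻ v, ‖patch z u v‖ₑ ^ 2 ∂patchMeasure S < ∞ at hu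
  rw [← eLpNorm_two_sq] at hu
  exact (ENNReal.pow_lt_top_iff.1 hu).resolve_right two_ne_zero

theorem stronglyMeasurable_patchMap {S : Set (Dom d)} [IsProbabilityMeasure (patchMeasure S)]
    {σ : ℝ → ℝ} (hσ : Continuous σ) (W : FilterBank S q p) {z : Dom d → Chan q}
    (hz : StronglyMeasurable z) : StronglyMeasurable fun u => patchMap σ W (patch z u) := by
  have h : ∀ i, StronglyMeasurable fun u => σ (applyFilters W (patch z u) i) := fun i => by
    refine hσ.comp_stronglyMeasurable (StronglyMeasurable.integral_prod_right
      (f := fun u v => inner ℝ (W i v) (z (u + v))) ?_)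
    exact ((Lp.stronglyMeasurable (W i)).comp_measurable measurable_snd).inner
      (hz.comp_measurable (measurable_fst.add measurable_snd))
  refine Measurable.stronglyMeasurable ?_
  exact (PiLp.continuous_toLp 2 _).measurable.comp (measurable_pi_lambda _ fun i => (h i).measurable)

/-- The patch maps of two signals differ by at most `ρ ‖W‖₂` times the difference of the signals,
where the second signal may be read off at displaced centres `ξ u`. The difference of the patches
is measured offset by offset, by Tonelli's theorem. -/
theorem eLpNorm_patchMap_sub_le {S : Set (Dom d)} (hS : IsCompact S) (hpos : 0 < volume S)
    {ρ : ℝ≥0} {σ : ℝ → ℝ} (hσ : LipschitzWith ρ σ) (W : FilterBank S q p)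
    {z₁ z₂ : Dom d → Chan q} (h₁ : StronglyMeasurable z₁) (h₂ : StronglyMeasurable z₂)
    (h₁' : MemLp z₁ 2) (h₂' : MemLp z₂ 2) {ξ : Dom d → Dom d}
    (hξ : Measure.QuasiMeasurePreserving ξ volume volume) {B : ℝ≥0∞}
    (hB : ∀ v ∈ S, eLpNorm (fun u => z₁ (u + v) - z₂ (ξ u + v)) 2 ≤ B) :
    eLpNorm (fun u => patchMap σ W (patch z₁ u) - patchMap σ W (patch z₂ (ξ u))) 2 ≤
      ENNReal.ofReal (ρ * spectralNorm W) * B := by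
  have := isProbabilityMeasure_patchMeasure hS hpos
  have hm : Measurable fun r : Dom d × Dom d => ‖z₁ (r.1 + r.2) - z₂ (ξ r.1 + r.2)‖ₑ ^ 2 :=
    ((h₁.comp_measurable (measurable_fst.add measurable_snd)).sub (h₂.comp_measurable
      ((hξ.measurable.comp measurable_fst).add measurable_snd))).enorm.pow_const 2
  rw [eLpNorm_two_le_iff]
  set C := ENNReal.ofReal (ρ * spectralNorm W)
  calc ∫⁻ u, ‖patchMap σ W (patch z₁ u) - patchMap σ W (patch z₂ (ξ u))‖ₑ ^ 2
      ≤ ∫⁻ u, C ^ 2 * ∫⁻ v, ‖z₁ (u + v) - z₂ (ξ u + v)‖ₑ ^ 2 ∂patchMeasure S := by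
        refine lintegral_mono_ae ?_
        filter_upwards [ae_memLp_patch (S := S) h₁ h₁', hξ.ae (ae_memLp_patch (S := S) h₂ h₂')]
          with u hu₁ hu₂
        refine (pow_le_pow_left' (enorm_patchMap_sub_le hσ W hu₁ hu₂) 2).trans_eq ?_
        rw [mul_pow, eLpNorm_two_sq]
        rfl
    _ = C ^ 2 * ∫⁻ v, (∫⁻ u, ‖z₁ (u + v) - z₂ (ξ u + v)‖ₑ ^ 2) ∂patchMeasure S := by
        rw [lintegral_const_mul _ (Measurable.lintegral_prod_right' (ν := patchMeasure S) hm),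
          lintegral_lintegral_swap hm.aemeasurable]
    _ ≤ C ^ 2 * ∫⁻ _, B ^ 2 ∂patchMeasure S := by
        refine mul_le_mul_right (lintegral_mono_ae ?_) _
        filter_upwards [ae_mem_patchMeasure hS] with v hv
        exact (eLpNorm_two_le_iff _ _).1 (hB v hv)
    _ = (C * B) ^ 2 := by
        rw [lintegral_const, measure_univ, mul_one, mul_pow]

theorem eLpNorm_comp_add_right {E : Type*} [NormedAddCommGroup E] {z : Dom d → E}
    (hz : StronglyMeasurable z) (v : Dom d) : eLpNorm (fun u => z (u + v)) 2 = eLpNorm z 2 :=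
  eLpNorm_comp_measurePreserving hz.aestronglyMeasurable (measurePreserving_add_right volume v)

theorem eLpNorm_patchMap_le {S : Set (Dom d)} (hS : IsCompact S) (hpos : 0 < volume S)
    {ρ : ℝ≥0} {σ : ℝ → ℝ} (hσ : LipschitzWith ρ σ) (hσ0 : σ 0 = 0) (W : FilterBank S q p)
    {z : Dom d → Chan q} (hz : StronglyMeasurable z) (hz2 : MemLp z 2) :
    eLpNorm (fun u => patchMap σ W (patch z u)) 2 ≤
      ENNReal.ofReal (ρ * spectralNorm W) * eLpNorm z 2 := by
  have h := eLpNorm_patchMap_sub_le hS hpos hσ W hz (z₂ := 0) stronglyMeasurable_zero hz2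
    MemLp.zero (Measure.QuasiMeasurePreserving.id _) (B := eLpNorm z 2) fun v _ => by
      simpa using (eLpNorm_comp_add_right hz v).le
  have e : ∀ u : Dom d, patchMap σ W (patch (0 : Dom d → Chan q) u) = 0 := fun u =>
    patchMap_zero hσ0 W
  simpa only [id, e, sub_zero] using h

end

section

variable {d n : ℕ}

/-! ### The layers of the network -/

namespace ConvNet

/-- The feature maps before pooling: `x` itself, and then `z̃_1, …, z̃_n`. -/
noncomputable def preFeature (N : ConvNet d n) (σ : ℝ → ℝ) (x : Dom d → Chan (N.p 0))
    (k : Fin (n + 1)) : Dom d → Chan (N.p k) :=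
  Fin.cases (motive := fun k => Dom d → Chan (N.p k)) x
    (fun k u => patchMap σ (N.W k) (patch (N.featureMap σ x k.castSucc) u)) k

variable (N : ConvNet d n) (σ : ℝ → ℝ) (x : Dom d → Chan (N.p 0))

theorem preFeature_zero : N.preFeature σ x 0 = x := rfl

theorem preFeature_succ (k : Fin n) : N.preFeature σ x k.succ =
    fun u => patchMap σ (N.W k) (patch (N.featureMap σ x k.castSucc) u) := rfl

theorem featureMap_eq_pool (k : Fin (n + 1)) :
    N.featureMap σ x k = pool (N.scale k) (N.preFeature σ x k) := by
  cases k using Fin.cases <;> rfl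

/-- The product of the Lipschitz constants `ρ ‖W_j‖₂` of the first `k` layers. -/
noncomputable def gain (ρ : ℝ≥0) (k : Fin (n + 1)) : ℝ≥0∞ :=
  Fin.partialProd (fun j => ENNReal.ofReal (ρ * spectralNorm (N.W j))) k

theorem gain_zero (ρ : ℝ≥0) : N.gain ρ 0 = 1 := Fin.partialProd_zero _

theorem gain_succ (ρ : ℝ≥0) (k : Fin n) : N.gain ρ k.succ =
    ENNReal.ofReal (ρ * spectralNorm (N.W k)) * N.gain ρ k.castSucc := by
  rw [gain, Fin.partialProd_succ, mul_comm, gain]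

theorem gain_last (ρ : ℝ≥0) : N.gain ρ (Fin.last n) =
    ENNReal.ofReal ((ρ : ℝ) ^ n * ∏ k, spectralNorm (N.W k)) := by
  have h : ((ρ : ℝ) ^ n * ∏ k, spectralNorm (N.W k)) = ∏ k, (ρ * spectralNorm (N.W k)) := by
    rw [Finset.prod_mul_distrib, Finset.prod_const, Finset.card_univ, Fintype.card_fin]
  rw [h, ENNReal.ofReal_prod_of_nonneg fun k _ => mul_nonneg ρ.coe_nonneg (spectralNorm_nonneg _),
    gain, Fin.partialProd, Fin.val_last, List.take_of_length_le (by simp), List.prod_ofFn]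

variable {N σ x} {ρ : ℝ≥0}

theorem gain_ne_top (k : Fin (n + 1)) : N.gain ρ k ≠ ∞ := by
  induction k using Fin.induction with
  | zero => simp [gain_zero]
  | succ k ih => rw [gain_succ]; exact ENNReal.mul_ne_top ENNReal.ofReal_ne_top ih

theorem stronglyMeasurable_preFeature (hσ : Continuous σ) (hx : StronglyMeasurable x)
    (k : Fin (n + 1)) : StronglyMeasurable (N.preFeature σ x k) := by
  induction k using Fin.induction with
  | zero => exact hx
  | succ k ih =>
    have := isProbabilityMeasure_patchMeasure (N.isCompact_S k) (N.volume_S_pos k)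
    rw [preFeature_succ]
    refine stronglyMeasurable_patchMap hσ _ ?_
    rw [featureMap_eq_pool]
    exact stronglyMeasurable_pool _ ih

theorem memLp_preFeature_and_eLpNorm_le (hσ : LipschitzWith ρ σ) (hσ0 : σ 0 = 0)
    (hx : StronglyMeasurable x) (hx2 : MemLp x 2) (k : Fin (n + 1)) :
    MemLp (N.preFeature σ x k) 2 ∧
      eLpNorm (N.preFeature σ x k) 2 ≤ N.gain ρ k * eLpNorm x 2 := by
  have hm := stronglyMeasurable_preFeature (N := N) hσ.continuous hx
  suffices h : eLpNorm (N.preFeature σ x k) 2 ≤ N.gain ρ k * eLpNorm x 2 from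
    ⟨⟨(hm k).aestronglyMeasurable, h.trans_lt (ENNReal.mul_lt_top (gain_ne_top k).lt_top hx2.2)⟩, h⟩
  induction k using Fin.induction with
  | zero => rw [gain_zero, one_mul, preFeature_zero]
  | succ k ih =>
    have hk2 : MemLp (N.preFeature σ x k.castSucc) 2 := ⟨(hm _).aestronglyMeasurable,
      ih.trans_lt (ENNReal.mul_lt_top (gain_ne_top _).lt_top hx2.2)⟩
    rw [preFeature_succ, gain_succ, mul_assoc, featureMap_eq_pool]
    refine (eLpNorm_patchMap_le (N.isCompact_S k) (N.volume_S_pos k) hσ hσ0 (N.W k)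
      (stronglyMeasurable_pool _ (hm _)) (memLp_pool (N.scale_pos _) (hm _) hk2)).trans ?_
    exact mul_le_mul_right ((eLpNorm_pool_le (N.scale_pos _) (hm _)).trans ih) _

theorem memLp_featureMap (hσ : LipschitzWith ρ σ) (hσ0 : σ 0 = 0)
    (hx : StronglyMeasurable x) (hx2 : MemLp x 2) (k : Fin (n + 1)) :
    MemLp (N.featureMap σ x k) 2 := by
  rw [featureMap_eq_pool]
  exact memLp_pool (N.scale_pos k) (stronglyMeasurable_preFeature hσ.continuous hx k)
    (memLp_preFeature_and_eLpNorm_le hσ hσ0 hx hx2 k).1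

end ConvNet

theorem stronglyMeasurable_warp {p : ℕ} {τ : Dom d → Dom d} (hτ : Continuous τ)
    {z : Dom d → Chan p} (hz : StronglyMeasurable z) : StronglyMeasurable (warp τ z) :=
  hz.comp_measurable (continuous_id.sub hτ).measurable

theorem memLp_warp {p : ℕ} {τ : Dom d → Dom d} (hτ : Continuous τ)
    (hhalf : ∀ x y, ‖τ x - τ y‖ ≤ 1 / 2 * ‖x - y‖) {z : Dom d → Chan p}
    (hz : StronglyMeasurable z) (hz2 : MemLp z 2) : MemLp (warp τ z) 2 :=
  ⟨(stronglyMeasurable_warp hτ hz).aestronglyMeasurable,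
    (eLpNorm_comp_le_of_antilipschitz (antilipschitz_id_sub hhalf)
      (continuous_id.sub hτ).measurable hz).trans_lt
        (ENNReal.mul_lt_top (ENNReal.pow_lt_top (by simp)) hz2.2)⟩

/-- A perturbed pooled signal `A_s z'`, compared with the deformation of `A_s z`: the error is that
of `z'` as an approximation of `L_τ z`, plus the commutator of `A_s` and `L_τ`. -/
theorem eLpNorm_pool_sub_comp_pool_le {p : ℕ} {s κ : ℝ} (hs : 0 < s) {z z' : Dom d → Chan p}
    (hz : StronglyMeasurable z) (hz2 : MemLp z 2) (hz' : StronglyMeasurable z')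
    (hz2' : MemLp z' 2) {τ : Dom d → Dom d} (hτ : ContDiff ℝ 1 τ)
    (hgrad : ∀ u, ‖fderiv ℝ τ u‖ ≤ 1 / 2) {c : Dom d} (hc : ‖c‖ ≤ κ * s) :
    eLpNorm (fun u => pool s z' (u + c) - pool s z (u - τ u + c)) 2 ≤
      eLpNorm (z' - warp τ z) 2 +
        ENNReal.ofReal (commutatorConst d κ * gradSupNorm τ) * eLpNorm z 2 := by
  have hw := stronglyMeasurable_warp hτ.continuous hz
  have hw2 := memLp_warp hτ.continuous (norm_sub_le_half hτ hgrad) hz hz2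
  have hd := hz'.sub hw
  have hpool := stronglyMeasurable_pool s hz
  have hpoolw := stronglyMeasurable_pool s hw
  have e : (fun u => pool s z' (u + c) - pool s z (u - τ u + c)) =
      (fun u => pool s (z' - warp τ z) (u + c)) +
        fun u => pool s (warp τ z) (u + c) - pool s z (u - τ u + c) := by
    ext1 u
    simp [pool_sub hs hz2' hw2]
  have hτm := hτ.continuous.measurable
  rw [e]
  refine (eLpNorm_add_le ((stronglyMeasurable_pool s hd).comp_measurable
    (measurable_add_const c)).aestronglyMeasurable ((hpoolw.comp_measurable
      (measurable_add_const c)).sub (hpool.comp_measurable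
        ((measurable_id.sub hτm).add_const c))).aestronglyMeasurable one_le_two).trans ?_
  refine add_le_add ?_ (eLpNorm_pool_warp_sub_le hs hz hz2 hτ hgrad hc)
  exact (eLpNorm_comp_add_right (stronglyMeasurable_pool s hd) c).trans_le (eLpNorm_pool_le hs hd)

/-! ### Stability -/

namespace ConvNet

variable {N : ConvNet d n} {σ : ℝ → ℝ} {x : Dom d → Chan (N.p 0)} {ρ : ℝ≥0} {κ : ℝ}
  {τ : Dom d → Dom d}

/-- The maps `x ↦ z̃_k` commute with `L_τ` up to one commutator for each layer. -/
theorem eLpNorm_preFeature_warp_sub_le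
    (hpatch : ∀ k : Fin n, ∀ c ∈ N.S k, ‖c‖ ≤ κ * N.scale k.castSucc)
    (hσ : LipschitzWith ρ σ) (hσ0 : σ 0 = 0) (hx : StronglyMeasurable x) (hx2 : MemLp x 2)
    (hτ : ContDiff ℝ 1 τ) (hgrad : ∀ u, ‖fderiv ℝ τ u‖ ≤ 1 / 2) (k : Fin (n + 1)) :
    eLpNorm (N.preFeature σ (warp τ x) k - warp τ (N.preFeature σ x k)) 2 ≤
      N.gain ρ k * ((k : ℕ) * ENNReal.ofReal (commutatorConst d κ * gradSupNorm τ) *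
        eLpNorm x 2) := by
  have hhalf := norm_sub_le_half hτ hgrad
  have hwx := stronglyMeasurable_warp hτ.continuous hx
  have hwx2 := memLp_warp hτ.continuous hhalf hx hx2
  have hm := stronglyMeasurable_preFeature (N := N) hσ.continuous hx
  have hm' := stronglyMeasurable_preFeature (N := N) hσ.continuous hwx
  have hm2 := fun k => (memLp_preFeature_and_eLpNorm_le (N := N) hσ hσ0 hx hx2 k).1
  have hle := fun k => (memLp_preFeature_and_eLpNorm_le (N := N) hσ hσ0 hx hx2 k).2
  have hm2' := fun k => (memLp_preFeature_and_eLpNorm_le (N := N) hσ hσ0 hwx hwx2 k).1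
  set D := ENNReal.ofReal (commutatorConst d κ * gradSupNorm τ)
  induction k using Fin.induction with
  | zero => simp [preFeature_zero]
  | succ k ih =>
    have hs := N.scale_pos k.castSucc
    have h := eLpNorm_patchMap_sub_le (N.isCompact_S k) (N.volume_S_pos k) hσ (N.W k)
      (stronglyMeasurable_pool _ (hm' k.castSucc)) (stronglyMeasurable_pool _ (hm k.castSucc))
      (memLp_pool hs (hm' _) (hm2' _)) (memLp_pool hs (hm _) (hm2 _))
      (quasiMeasurePreserving_of_antilipschitz (antilipschitz_id_sub hhalf)
        (continuous_id.sub hτ.continuous).measurable)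
      fun v hv => eLpNorm_pool_sub_comp_pool_le hs (hm _) (hm2 _) (hm' _) (hm2' _) hτ hgrad
        (hpatch k v hv)
    rw [← featureMap_eq_pool, ← featureMap_eq_pool] at h
    refine (h.trans (mul_le_mul_right (add_le_add ih (mul_le_mul_right (hle _) _)) _)).trans_eq ?_
    rw [gain_succ, Fin.val_succ, Fin.val_castSucc]
    push_cast
    ring

theorem eLpNorm_featureMap_warp_sub_le
    (hpatch : ∀ k : Fin n, ∀ c ∈ N.S k, ‖c‖ ≤ κ * N.scale k.castSucc) (hκ : 0 ≤ κ)
    (hσ : LipschitzWith ρ σ) (hσ0 : σ 0 = 0) (hx : StronglyMeasurable x) (hx2 : MemLp x 2)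
    (hτ : ContDiff ℝ 1 τ) (hbdd : BddAbove (range fun u => ‖τ u‖))
    (hgrad : ∀ u, ‖fderiv ℝ τ u‖ ≤ 1 / 2) (k : Fin (n + 1)) :
    eLpNorm (N.featureMap σ (warp τ x) k - N.featureMap σ x k) 2 ≤
      N.gain ρ k * (((k : ℕ) + 1) * ENNReal.ofReal (commutatorConst d κ * gradSupNorm τ) +
        ENNReal.ofReal (translationConst d / N.scale k * supNorm τ)) * eLpNorm x 2 := by
  have hhalf := norm_sub_le_half hτ hgrad
  have hwx := stronglyMeasurable_warp hτ.continuous hx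
  have hwx2 := memLp_warp hτ.continuous hhalf hx hx2
  have hm := stronglyMeasurable_preFeature (N := N) hσ.continuous hx k
  have hm' := stronglyMeasurable_preFeature (N := N) hσ.continuous hwx k
  obtain ⟨hm2, hle⟩ := memLp_preFeature_and_eLpNorm_le (N := N) hσ hσ0 hx hx2 k
  have hm2' := (memLp_preFeature_and_eLpNorm_le (N := N) hσ hσ0 hwx hwx2 k).1
  have hs := N.scale_pos k
  have h1 := eLpNorm_preFeature_warp_sub_le hpatch hσ hσ0 hx hx2 hτ hgrad k
  have h2 := eLpNorm_pool_sub_comp_pool_le (κ := κ) (c := 0) hs hm hm2 hm' hm2' hτ hgrad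
    (by rw [norm_zero]; positivity)
  have h3 := eLpNorm_pool_comp_sub_pool_le hs hτ.continuous hbdd hhalf hm hm2
  simp only [add_zero, ← featureMap_eq_pool] at h2 h3
  set D := ENNReal.ofReal (commutatorConst d κ * gradSupNorm τ)
  set T := ENNReal.ofReal (translationConst d / N.scale k * supNorm τ)
  have hf : StronglyMeasurable (N.featureMap σ x k) := by
    rw [featureMap_eq_pool]; exact stronglyMeasurable_pool _ hm
  have hf' : StronglyMeasurable (N.featureMap σ (warp τ x) k) := by
    rw [featureMap_eq_pool]; exact stronglyMeasurable_pool _ hm'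
  have hfw := stronglyMeasurable_warp hτ.continuous hf
  have e : N.featureMap σ (warp τ x) k - N.featureMap σ x k =
      (fun u => N.featureMap σ (warp τ x) k u - N.featureMap σ x k (u - τ u)) +
        fun u => N.featureMap σ x k (u - τ u) - N.featureMap σ x k u := by
    ext1 u; simp
  rw [e]
  refine (eLpNorm_add_le (hf'.sub hfw).aestronglyMeasurable
    (hfw.sub hf).aestronglyMeasurable one_le_two).trans ?_
  refine (add_le_add (h2.trans (add_le_add h1 (mul_le_mul_right hle _)))
    (h3.trans (mul_le_mul_right hle _))).trans_eq ?_
  ring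

end ConvNet

/-- The Cauchy–Schwarz inequality for the linear prediction layer. -/
theorem abs_integral_inner_sub_le {p : ℕ} (w : Lp (Chan p) 2 (volume : Measure (Dom d)))
    {z₁ z₂ : Dom d → Chan p} (h₁ : MemLp z₁ 2) (h₂ : MemLp z₂ 2) :
    |(∫ u, inner ℝ (w u) (z₁ u)) - ∫ u, inner ℝ (w u) (z₂ u)| ≤
      ‖w‖ * (eLpNorm (z₁ - z₂) 2).toReal := by
  have e : ∀ {z : Dom d → Chan p} (h : MemLp z 2), ∫ u, inner ℝ (w u) (z u) = inner ℝ w h.toLp :=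
    fun {z} h => by
      rw [L2.inner_def]
      refine integral_congr_ae ?_
      filter_upwards [h.coeFn_toLp] with u hu
      rw [hu]
  rw [e h₁, e h₂, ← inner_sub_right, ← MemLp.toLp_sub, ← Lp.norm_toLp _ (h₁.sub h₂)]
  exact abs_real_inner_le_norm _ _

end

end GenericCNN

open GenericCNN MeasureTheory
open scoped ENNReal

theorem mainTheorem8 (d : ℕ) (κ : ℝ) (hκ : 0 < κ) :
    ∃ C₁ : ℝ, 0 ≤ C₁ ∧
      ∀ (n : ℕ) (N : GenericCNN.ConvNet d n)
        (_hpatch : ∀ k : Fin n, ∀ c ∈ N.S k, ‖c‖ ≤ κ * N.scale k.castSucc)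
        (ρ : NNReal) (σ : ℝ → ℝ) (_hσ : LipschitzWith ρ σ) (_hσ0 : σ 0 = 0)
        (τ : GenericCNN.Dom d → GenericCNN.Dom d) (_hτ : ContDiff ℝ 1 τ)
        (_hτbdd : BddAbove (Set.range fun u => ‖τ u‖))
        (_hτgrad : ∀ u, ‖fderiv ℝ τ u‖ ≤ 1 / 2)
        (x : MeasureTheory.Lp (GenericCNN.Chan (N.p 0)) 2
          (MeasureTheory.volume : MeasureTheory.Measure (GenericCNN.Dom d))),
        (∀ k, MeasureTheory.MemLp (N.featureMap σ x k) 2 MeasureTheory.volume) ∧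
        (∀ k, MeasureTheory.MemLp (N.featureMap σ (GenericCNN.warp τ x) k) 2
          MeasureTheory.volume) ∧
        |N.predict σ (GenericCNN.warp τ x) - N.predict σ x| ≤
          (ρ : ℝ) ^ n * ‖N.wOut‖ * (∏ k, GenericCNN.spectralNorm (N.W k)) *
            (C₁ * (1 + n) * GenericCNN.gradSupNorm τ +
              GenericCNN.translationConst d / N.scale (Fin.last n) * GenericCNN.supNorm τ) *
            ‖x‖ := by
  refine ⟨commutatorConst d κ, commutatorConst_nonneg d κ, ?_⟩
  intro n N hpatch ρ σ hσ hσ0 τ hτ hbdd hgrad x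
  have hx := Lp.stronglyMeasurable x
  have hx2 := Lp.memLp x
  have hwx := stronglyMeasurable_warp hτ.continuous hx
  have hwx2 := memLp_warp hτ.continuous (norm_sub_le_half hτ hgrad) hx hx2
  have hz := ConvNet.memLp_featureMap (N := N) hσ hσ0 hx hx2
  have hz' := ConvNet.memLp_featureMap (N := N) hσ hσ0 hwx hwx2
  refine ⟨hz, hz', (abs_integral_inner_sub_le N.wOut (hz' _) (hz _)).trans ?_⟩
  have h := ConvNet.eLpNorm_featureMap_warp_sub_le hpatch hκ.le hσ hσ0 hx hx2 hτ hbdd hgrad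
    (Fin.last n)
  have hC := commutatorConst_nonneg d κ
  have hg := gradSupNorm_nonneg τ
  have hP : 0 ≤ ∏ k, spectralNorm (N.W k) := Finset.prod_nonneg fun k _ => spectralNorm_nonneg _
  have hs := N.scale_pos (Fin.last n)
  have hT : 0 ≤ translationConst d / N.scale (Fin.last n) * supNorm τ :=
    mul_nonneg (div_nonneg (mul_nonneg (by positivity)
      (integral_nonneg fun _ => norm_nonneg _)) hs.le) (Real.iSup_nonneg fun _ => norm_nonneg _)
  have hn : (((Fin.last n : Fin (n + 1)) : ℕ) + 1 : ℝ≥0∞) = ENNReal.ofReal (1 + n) := by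
    rw [Fin.val_last, ENNReal.ofReal_add zero_le_one (Nat.cast_nonneg n), ENNReal.ofReal_one,
      ENNReal.ofReal_natCast, add_comm]
  have hxn : eLpNorm x 2 = ENNReal.ofReal ‖x‖ := by
    rw [Lp.norm_def, ENNReal.ofReal_toReal hx2.2.ne]
  rw [ConvNet.gain_last, hn, hxn, ← ENNReal.ofReal_mul (by positivity),
    ← ENNReal.ofReal_add (by positivity) hT, ← ENNReal.ofReal_mul (by positivity),
    ← ENNReal.ofReal_mul (by positivity)] at h
  have h' := ENNReal.toReal_le_of_le_ofReal (by positivity) h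
  exact (mul_le_mul_of_nonneg_left h' (norm_nonneg N.wOut)).trans_eq (by ring)
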